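/- Let $r>1$, let $\alpha_1\ge\alpha_2\ge\cdots\ge\alpha_r>0$, let $m_1,\dots,m_r>0$ and $\nu>0$ be real numbers, and put $|m|=m_1+\cdots+m_r$. Let $X_1,\dots,X_r,V$ be real random variables such that $X_1,\dots,X_r$ are mutually independent, $V$ is independent of $(X_1,\dots,X_r)$, $X_i$ has the chi-square distribution with $m_i$ degrees of freedom and $V$ has the chi-square distribution with $\nu$ degrees of freedom. Let $$W=\frac{(\alpha_1X_1+\cdots+\alpha_rX_r)/|m|}{V/\nu}.$$ Put $u_i=1-\alpha_r/\alpha_i$ and $A=\prod_{i=1}^r(\alpha_i/\alpha_r)^{-m_i/2}$, and let $c_0,c_1,\dots$ be the coefficients of the power series at $z=0$ $$A\prod_{i=1}^r(1-u_iz)^{-m_i/2}=\sum_{j=0}^\infty c_jz^j .$$ Put $$a=\frac{\nu\alpha_r}{|m|},\quad B_0=a^{\nu/2}\frac{\Gamma\left(\frac{\nu+|m|}2\right)}{\Gamma\left(\frac{|m|}2\right)\Gamma\left(\frac\nu2\right)},\quad B_1(y)=\frac{y^{(|m|-2)/2}}{(a+y)^{(\nu+|m|)/2}},\quad t(y)=\frac{y}{a+y},$$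 let $(x)_n=x(x+1)\cdots(x+n-1)$, and for an integer $\tau\ge0$ and $y\ge0$ (with $yB_1(y)$ read as $0$ at $y=0$) let $$\widehat H_W(y)=B_0B_1(y)\frac{y}{|m|/2}\sum_{j=0}^{\tau}\frac{\left(\frac{\nu+|m|}2\right)_j}{\left(\frac{|m|}2+1\right)_j}\,t(y)^j\sum_{i=0}^jc_i,$$ $$C_\tau(y)=B_0B_1(y)\frac{y}{|m|/2}\,\frac{\left(\frac{\nu+|m|}2\right)_{\tau+1}}{\left(\frac{|m|}2+1\right)_{\tau+1}}\,t(y)^{\tau+1}\,{}_2F_1\left(\frac{\nu+|m|}2+\tau+1,\,1;\ \frac{|m|}2+\tau+2;\ t(y)\right).$$ Then for every integer $\tau\ge0$ and every real $y\ge0$, the quantity $\widehat H_W(y)+C_\tau(y)$ estimates $P[W\le y]$ with $$\left|P[W\le y]-\left(\widehat H_W(y)+C_\tau(y)\right)\right|\le e^*_\tau(y):=\left(1-\sum_{i=0}^{\tau+1}c_i\right)C_\tau(y).$$ -/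

import Mathlib

open MeasureTheory ProbabilityTheory

namespace GenF

noncomputable section

/-- The chi-square distribution with `k` degrees of freedom: the Gamma distribution with
shape `k / 2` and rate `1 / 2`, i.e. density `x ^ (k/2 - 1) * exp (-x/2) / (2^(k/2) Γ(k/2))`
on `[0, ∞)`. -/
def chiSquare (k : ℝ) : Measure ℝ := gammaMeasure (k / 2) (1 / 2)

/-- The rising factorial `(x)_n = x (x + 1) ⋯ (x + n - 1)`. -/
def poch (x : ℝ) (n : ℕ) : ℝ := (ascPochhammer ℝ n).eval x

/-- `|m| = m_1 + ⋯ + m_r`. -/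
def total {r : ℕ} (m : Fin r → ℝ) : ℝ := ∑ i, m i

/-- The generalized `F` variable `W = (T / |m|) / (V / ν)` with `T = ∑ α_i X_i`. -/
def W {Ω : Type*} {r : ℕ} (α m : Fin r → ℝ) (ν : ℝ) (X : Fin r → Ω → ℝ) (V : Ω → ℝ) (ω : Ω) : ℝ :=
  ((∑ i, α i * X i ω) / total m) / (V ω / ν)

/-- The last weight `α_r`. -/
def lastWeight {r : ℕ} (hr : 1 < r) (α : Fin r → ℝ) : ℝ := α ⟨r - 1, by omega⟩

/-- `u_i = 1 - α_r / α_i`. -/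
def u {r : ℕ} (hr : 1 < r) (α : Fin r → ℝ) (i : Fin r) : ℝ := 1 - lastWeight hr α / α i

/-- `A = ∏ (α_i / α_r) ^ (-m_i / 2)`. -/
def A {r : ℕ} (hr : 1 < r) (α m : Fin r → ℝ) : ℝ :=
  ∏ i, (α i / lastWeight hr α) ^ (-(m i / 2))

/-- The generating function `A ∏ (1 - u_i z) ^ (-m_i / 2)`. -/
def genFun {r : ℕ} (hr : 1 < r) (α m : Fin r → ℝ) (z : ℝ) : ℝ :=
  A hr α m * ∏ i, (1 - u hr α i * z) ^ (-(m i / 2))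

/-- The coefficients `c_j` in `A ∏ (1 - u_i z) ^ (-m_i / 2) = ∑ c_j z ^ j`: the Taylor
coefficients of the left-hand side at `z = 0`. -/
def c {r : ℕ} (hr : 1 < r) (α m : Fin r → ℝ) (j : ℕ) : ℝ :=
  iteratedDeriv j (genFun hr α m) 0 / (j.factorial : ℝ)

/-- `a = ν α_r / |m|`. -/
def a {r : ℕ} (hr : 1 < r) (α m : Fin r → ℝ) (ν : ℝ) : ℝ := ν * lastWeight hr α / total m

/-- `B₀ = a ^ (ν/2) Γ((ν + |m|)/2) / (Γ(|m|/2) Γ(ν/2))`. -/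
def B₀ {r : ℕ} (hr : 1 < r) (α m : Fin r → ℝ) (ν : ℝ) : ℝ :=
  a hr α m ν ^ (ν / 2) * Real.Gamma ((ν + total m) / 2) /
    (Real.Gamma (total m / 2) * Real.Gamma (ν / 2))

/-- `B₁(w) = w ^ ((|m| - 2)/2) / (a + w) ^ ((ν + |m|)/2)`. -/
def B₁ {r : ℕ} (hr : 1 < r) (α m : Fin r → ℝ) (ν w : ℝ) : ℝ :=
  w ^ ((total m - 2) / 2) / (a hr α m ν + w) ^ ((ν + total m) / 2)

/-- `t(w) = w / (a + w)`. -/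
def t {r : ℕ} (hr : 1 < r) (α m : Fin r → ℝ) (ν w : ℝ) : ℝ := w / (a hr α m ν + w)

/-- The partial sum estimate `Ĥ_W(y)` of the cdf of `W`, with the terms `j = 0, …, τ`. -/
def HHat {r : ℕ} (hr : 1 < r) (α m : Fin r → ℝ) (ν : ℝ) (τ : ℕ) (y : ℝ) : ℝ :=
  B₀ hr α m ν * B₁ hr α m ν y * (y / (total m / 2)) *
    ∑ j ∈ Finset.range (τ + 1),
      poch ((ν + total m) / 2) j / poch (total m / 2 + 1) j * t hr α m ν y ^ j *
        ∑ i ∈ Finset.range (j + 1), c hr α m i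

/-- The scaled `₂F₁` correction term. -/
def correction {r : ℕ} (hr : 1 < r) (α m : Fin r → ℝ) (ν : ℝ) (τ : ℕ) (y : ℝ) : ℝ :=
  B₀ hr α m ν * B₁ hr α m ν y * (y / (total m / 2)) *
    (poch ((ν + total m) / 2) (τ + 1) / poch (total m / 2 + 1) (τ + 1)) *
    t hr α m ν y ^ (τ + 1) *
    ₂F₁ ((ν + total m) / 2 + τ + 1) (1 : ℝ) (total m / 2 + τ + 2) (t hr α m ν y)

/-- The local truncation error bound `e*_τ(y)`. -/
def errorBound {r : ℕ} (hr : 1 < r) (α m : Fin r → ℝ) (ν : ℝ) (τ : ℕ) (y : ℝ) : ℝ :=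
  (1 - ∑ i ∈ Finset.range (τ + 2), c hr α m i) * correction hr α m ν τ y

end

end GenF

/-! Put T = ∑ α_i X_i. For t near 0 and z = 1/(1 - 2 α_r t), the moment generating function ∏ (1 - 2
α_i t)^(-m_i/2) of T equals z^(|m|/2) · `genFun` z. Expanding in z shows that T is a mixture, with
weights c_j, of gamma laws of shape |m|/2 + j and rate 1/(2 α_r) (`map_weighted_sum_eq_mixture`).
The c_j are nonnegative, since every u_i is, and sum to `genFun` 1 = 1.

Conditionally on V, each gamma distribution function is a Poisson-type series. Averaging over V
turns the k-th term for shape |m|/2 + j into a number d_(j+k) (`betaTerm`, `seriesTerm`). Collecting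
n = j + k gives P[W ≤ y] = ∑ d_n S_n with S_n = c_0 + ⋯ + c_n (`measure_W_le_eq_tsum`).

`HHat` is the sum over n ≤ τ, and `correction` is ∑ d_n over n > τ, that is, the tail with S_n
replaced by 1. There S_(τ+1) ≤ S_n ≤ 1, so the error is at most (1 - S_(τ+1)) times that tail
(`abs_tsum_mul_sub_le`). -/

/-! ### Power series with nonnegative coefficients -/

/-- The binomial series of `(1 - x) ^ (-β)`. -/
theorem hasSum_one_sub_rpow_neg (β : ℝ) {x : ℝ} (hx : |x| < 1) :
    HasSum (fun n : ℕ => Ring.multichoose β n * x ^ n) ((1 - x) ^ (-β)) := by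
  have h := (Real.one_div_one_sub_rpow_hasFPowerSeriesOnBall_zero β).hasSum (y := x)
    (by simpa [enorm_eq_nnnorm, ← NNReal.coe_lt_coe] using hx)
  have hx' : 0 ≤ 1 - x := by linarith [(abs_lt.1 hx).2]
  simpa [FormalMultilinearSeries.ofScalars_apply_eq, Ring.multichoose_eq, Real.rpow_neg hx', mul_comm,
    zero_add] using h

theorem multichoose_nonneg_of_pos {β : ℝ} (hβ : 0 < β) (n : ℕ) : 0 ≤ Ring.multichoose β n := by
  have h := Ring.factorial_nsmul_multichoose_eq_ascPochhammer β n
  rw [Polynomial.ascPochhammer_smeval_eq_eval, nsmul_eq_mul] at h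
  have h1 := ascPochhammer_pos n β hβ
  rw [← h] at h1
  exact (pos_of_mul_pos_right h1 (by positivity)).le

/-- Products of power series with nonnegative coefficients are again of this form. -/
theorem exists_nonneg_hasSum_mul {S : Set ℝ} (hS : ∀ z ∈ S, |z| ∈ S) {f g : ℝ → ℝ}
    (hf : ∃ b : ℕ → ℝ, (∀ n, 0 ≤ b n) ∧ ∀ z ∈ S, HasSum (fun n => b n * z ^ n) (f z))
    (hg : ∃ b : ℕ → ℝ, (∀ n, 0 ≤ b n) ∧ ∀ z ∈ S, HasSum (fun n => b n * z ^ n) (g z)) :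
    ∃ b : ℕ → ℝ, (∀ n, 0 ≤ b n) ∧ ∀ z ∈ S, HasSum (fun n => b n * z ^ n) (f z * g z) := by
  obtain ⟨b, hb, hb'⟩ := hf
  obtain ⟨d, hd, hd'⟩ := hg
  refine ⟨fun n => ∑ kl ∈ Finset.HasAntidiagonal.antidiagonal n, b kl.1 * d kl.2,
    fun n => Finset.sum_nonneg fun _ _ => mul_nonneg (hb _) (hd _), fun z hz => ?_⟩
  -- Nonnegative coefficients turn convergence at |z| into absolute convergence at z; hence the
  -- closure of `S` under absolute value.
  have key : ∀ {e : ℕ → ℝ} {s : ℝ → ℝ}, (∀ n, 0 ≤ e n) →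
      (∀ z ∈ S, HasSum (fun n => e n * z ^ n) (s z)) → Summable fun n => ‖e n * z ^ n‖ := by
    intro e s he h
    refine (h _ (hS z hz)).summable.congr fun n => ?_
    rw [norm_mul, norm_pow, Real.norm_of_nonneg (he n), Real.norm_eq_abs]
  have hB := key hb hb'
  have hD := key hd hd'
  have hs : ∀ n, (∑ kl ∈ Finset.HasAntidiagonal.antidiagonal n, b kl.1 * d kl.2) * z ^ n =
      ∑ kl ∈ Finset.HasAntidiagonal.antidiagonal n, (b kl.1 * z ^ kl.1) * (d kl.2 * z ^ kl.2) := by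
    intro n
    rw [Finset.sum_mul]
    refine Finset.sum_congr rfl fun kl hkl => ?_
    rw [← Finset.HasAntidiagonal.mem_antidiagonal.1 hkl, pow_add]
    ring
  simp_rw [hs]
  rw [← (hb' z hz).tsum_eq, ← (hd' z hz).tsum_eq,
    tsum_mul_tsum_eq_tsum_sum_antidiagonal_of_summable_norm hB hD]
  exact (summable_norm_sum_mul_antidiagonal_of_summable_norm hB hD).of_norm.hasSum

theorem exists_nonneg_hasSum_prod_one_sub {ι : Type*} (s : Finset ι) (u β : ι → ℝ) {U : ℝ}
    (hu : ∀ i, 0 ≤ u i) (hU : ∀ i, u i ≤ U) (hβ : ∀ i, 0 < β i) :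
    ∃ b : ℕ → ℝ, (∀ n, 0 ≤ b n) ∧ ∀ z ∈ {z : ℝ | |z| * U < 1},
      HasSum (fun n => b n * z ^ n) (∏ i ∈ s, (1 - u i * z) ^ (-β i)) := by
  classical
  induction s using Finset.induction_on with
  | empty =>
    refine ⟨fun n => if n = 0 then 1 else 0, fun n => by positivity, fun z _ => ?_⟩
    convert! hasSum_ite_eq (0 : ℕ) (1 : ℝ) using 2 with n
    by_cases h : n = 0 <;> simp [h]
  | insert i s hi ih =>
    simp_rw [Finset.prod_insert hi]
    refine exists_nonneg_hasSum_mul (fun z hz => by simpa using hz)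
      ⟨fun n => Ring.multichoose (β i) n * u i ^ n,
        fun n => mul_nonneg (multichoose_nonneg_of_pos (hβ i) n) (pow_nonneg (hu i) n),
        fun z hz => ?_⟩ ih
    have h1 : |u i * z| < 1 := by
      rw [abs_mul, abs_of_nonneg (hu i)]
      calc u i * |z| ≤ U * |z| := mul_le_mul_of_nonneg_right (hU i) (abs_nonneg z)
        _ < 1 := by rw [mul_comm]; exact hz
    simpa [mul_pow, mul_assoc] using hasSum_one_sub_rpow_neg (β i) h1

/-- A convergent power series expansion determines the Taylor coefficients. -/
theorem iteratedDeriv_div_factorial_eq_of_hasSum {f : ℝ → ℝ} {b : ℕ → ℝ}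
    (h : ∀ᶠ z in nhds (0 : ℝ), HasSum (fun n => b n * z ^ n) (f z)) (n : ℕ) :
    iteratedDeriv n f 0 / (n.factorial : ℝ) = b n := by
  have h1 : HasFPowerSeriesAt f (FormalMultilinearSeries.ofScalars ℝ b) 0 := by
    rw [hasFPowerSeriesAt_iff]
    filter_upwards [h] with z hz
    simpa [FormalMultilinearSeries.coeff_ofScalars, mul_comm] using hz
  have h2 := h1.analyticAt.hasFPowerSeriesAt.eq_formalMultilinearSeries h1
  have h3 := congrArg (fun p => FormalMultilinearSeries.coeff p n) h2
  simpa [FormalMultilinearSeries.coeff_ofScalars] using h3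

/-! ### The weights c_j -/

namespace GenF

theorem lastWeight_pos {r : ℕ} (hr : 1 < r) {α : Fin r → ℝ} (hα_pos : ∀ i, 0 < α i) :
    0 < lastWeight hr α := hα_pos _

theorem lastWeight_le {r : ℕ} (hr : 1 < r) {α : Fin r → ℝ} (hα_anti : Antitone α) (i : Fin r) :
    lastWeight hr α ≤ α i :=
  hα_anti (Fin.le_def.2 (by have := i.2; simp only; omega))

theorem u_nonneg {r : ℕ} (hr : 1 < r) {α : Fin r → ℝ} (hα_anti : Antitone α)
    (hα_pos : ∀ i, 0 < α i) (i : Fin r) : 0 ≤ u hr α i := by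
  have := (div_le_one (hα_pos i)).2 (lastWeight_le hr hα_anti i)
  rw [u]; linarith

theorem exists_u_le {r : ℕ} (hr : 1 < r) {α : Fin r → ℝ} (hα_anti : Antitone α)
    (hα_pos : ∀ i, 0 < α i) : ∃ U, 0 ≤ U ∧ U < 1 ∧ ∀ i, u hr α i ≤ U := by
  have hl := lastWeight_pos hr hα_pos
  refine ⟨u hr α ⟨0, by omega⟩, u_nonneg hr hα_anti hα_pos _, ?_, fun i => ?_⟩
  · have := div_pos hl (hα_pos ⟨0, by omega⟩)
    rw [u]; linarith
  · have := div_le_div_of_nonneg_left hl.le (hα_pos i)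
      (hα_anti (a := ⟨0, by omega⟩) (b := i) (Fin.le_def.2 (Nat.zero_le _)))
    rw [u, u]; linarith

theorem A_pos {r : ℕ} (hr : 1 < r) {α : Fin r → ℝ} (m : Fin r → ℝ) (hα_pos : ∀ i, 0 < α i) :
    0 < A hr α m :=
  Finset.prod_pos fun i _ => Real.rpow_pos_of_pos (div_pos (hα_pos i) (lastWeight_pos hr hα_pos)) _

/-- As U < 1, the region |z| U < 1 contains z = 1, where the c_j are summed, and a neighbourhood of
1, where the moment generating function lives. -/
theorem c_nonneg_and_hasSum {r : ℕ} (hr : 1 < r) {α m : Fin r → ℝ} (hα_anti : Antitone α)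
    (hα_pos : ∀ i, 0 < α i) (hm : ∀ i, 0 < m i) {U : ℝ} (hU0 : 0 ≤ U) (hU1 : U < 1)
    (hU : ∀ i, u hr α i ≤ U) :
    (∀ j, 0 ≤ c hr α m j) ∧
      ∀ z : ℝ, |z| * U < 1 → HasSum (fun j => c hr α m j * z ^ j) (genFun hr α m z) := by
  obtain ⟨b, hb, hs⟩ := exists_nonneg_hasSum_prod_one_sub Finset.univ (u hr α) (fun i => m i / 2)
    (u_nonneg hr hα_anti hα_pos) hU (fun i => half_pos (hm i))
  have hs' : ∀ z : ℝ, |z| * U < 1 →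
      HasSum (fun j => A hr α m * b j * z ^ j) (genFun hr α m z) := by
    intro z hz
    simpa only [genFun, mul_assoc] using (hs z hz).mul_left (A hr α m)
  have hc : ∀ j, c hr α m j = A hr α m * b j := by
    refine iteratedDeriv_div_factorial_eq_of_hasSum ?_
    filter_upwards [Metric.ball_mem_nhds (0 : ℝ) one_pos] with z hz
    refine hs' z ?_
    have hz' : |z| < 1 := by simpa using hz
    nlinarith [abs_nonneg z]
  refine ⟨fun j => ?_, fun z hz => ?_⟩
  · rw [hc]; exact mul_nonneg (A_pos hr m hα_pos).le (hb j)
  · simpa only [hc] using hs' z hz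

/-- The constant A is the normalization that makes the c_j sum to 1. -/
theorem genFun_one {r : ℕ} (hr : 1 < r) {α : Fin r → ℝ} (m : Fin r → ℝ)
    (hα_pos : ∀ i, 0 < α i) : genFun hr α m 1 = 1 := by
  have hl := lastWeight_pos hr hα_pos
  rw [genFun, A, ← Finset.prod_mul_distrib]
  refine Finset.prod_eq_one fun i _ => ?_
  have hi := hα_pos i
  rw [← Real.mul_rpow (by positivity) (by rw [u]; simp; positivity)]
  have : α i / lastWeight hr α * (1 - u hr α i * 1) = 1 := by rw [u]; field_simp; ring
  rw [this, Real.one_rpow]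

end GenF

/-! ### Moment generating functions and the law of the weighted sum -/

/-- Exponential tilting: the factor exp(t x) turns the density of rate r into a multiple of the
density of rate r - t. -/
theorem lintegral_exp_mul_gammaMeasure {a r t : ℝ} (ha : 0 < a) (hr : 0 < r) (ht : t < r) :
    ∫⁻ x, ENNReal.ofReal (Real.exp (t * x)) ∂gammaMeasure a r =
      ENNReal.ofReal ((r / (r - t)) ^ a) := by
  have hrt : 0 < r - t := by linarith
  have hmeas : Measurable (gammaPDF a r) := (measurable_gammaPDFReal a r).ennreal_ofReal
  rw [gammaMeasure, lintegral_withDensity_eq_lintegral_mul _ hmeas (by fun_prop)]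
  have h : ∀ x, (gammaPDF a r * fun x => ENNReal.ofReal (Real.exp (t * x))) x =
      ENNReal.ofReal ((r / (r - t)) ^ a) * gammaPDF a (r - t) x := by
    intro x
    rw [Pi.mul_apply, gammaPDF, gammaPDF, ← ENNReal.ofReal_mul (gammaPDFReal_nonneg ha hr x),
      ← ENNReal.ofReal_mul (by positivity)]
    congr 1
    unfold gammaPDFReal
    split_ifs
    · rw [Real.div_rpow hr.le hrt.le,
        show -((r - t) * x) = -(r * x) + t * x by ring, Real.exp_add]
      have := (Real.rpow_pos_of_pos hrt a).ne'
      field_simp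
    · simp
  simp_rw [h]
  rw [lintegral_const_mul' _ _ ENNReal.ofReal_ne_top, lintegral_gammaPDF_eq_one ha hrt, mul_one]

theorem mgf_eq_toReal_lintegral {Ω : Type*} [MeasurableSpace Ω] {μ : Measure Ω} {X : Ω → ℝ}
    (hX : AEMeasurable X μ) (t : ℝ) :
    mgf X μ t = (∫⁻ ω, ENNReal.ofReal (Real.exp (t * X ω)) ∂μ).toReal := by
  rw [mgf, integral_eq_lintegral_of_nonneg_ae (Filter.Eventually.of_forall fun _ => by positivity)
    (by fun_prop)]

theorem mem_integrableExpSet_of_lintegral_ne_top {Ω : Type*} [MeasurableSpace Ω] {μ : Measure Ω}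
    {X : Ω → ℝ} (hX : AEMeasurable X μ) {t : ℝ}
    (h : ∫⁻ ω, ENNReal.ofReal (Real.exp (t * X ω)) ∂μ ≠ ⊤) : t ∈ integrableExpSet X μ :=
  (lintegral_ofReal_ne_top_iff_integrable (by fun_prop)
    (Filter.Eventually.of_forall fun _ => by positivity)).1 h

theorem mgf_gammaMeasure {a r t : ℝ} (ha : 0 < a) (hr : 0 < r) (ht : t < r) :
    mgf id (gammaMeasure a r) t = (r / (r - t)) ^ a := by
  have hrt : 0 < r - t := by linarith
  rw [mgf_eq_toReal_lintegral aemeasurable_id]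
  simp only [id]
  rw [lintegral_exp_mul_gammaMeasure ha hr ht, ENNReal.toReal_ofReal (by positivity)]

/-- Finite measures on `ℝ` whose moment generating functions are finite and agree in a
neighbourhood of `0` are equal. -/
theorem ext_of_mgf_eqOn_Ioo {μ μ' : Measure ℝ} [IsFiniteMeasure μ] [IsFiniteMeasure μ'] {ε : ℝ}
    (hε : 0 < ε) (hμ : Set.Ioo (-ε) ε ⊆ integrableExpSet id μ)
    (hμ' : Set.Ioo (-ε) ε ⊆ integrableExpSet id μ')
    (h : ∀ t ∈ Set.Ioo (-ε) ε, mgf id μ t = mgf id μ' t) : μ = μ' := by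
  have hsub : ∀ {κ : Measure ℝ}, Set.Ioo (-ε) ε ⊆ integrableExpSet id κ →
      AnalyticOnNhd ℂ (complexMGF id κ) {z | z.re ∈ Set.Ioo (-ε) ε} := fun hκ z hz =>
    analyticAt_complexMGF ((interior_maximal hκ isOpen_Ioo) hz)
  have hconv : IsPreconnected {z : ℂ | z.re ∈ Set.Ioo (-ε) ε} :=
    ((convex_Ioo (-ε) ε).linear_preimage Complex.reLm).isPreconnected
  have hfreq : ∃ᶠ z in nhdsWithin (0 : ℂ) {0}ᶜ, complexMGF id μ z = complexMGF id μ' z := by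
    rw [Filter.frequently_iff_seq_forall]
    -- Points of agreement accumulating at 0, for the identity theorem on the strip; n + 2 keeps
    -- even the first one strictly below ε.
    refine ⟨fun n : ℕ => ((ε / (n + 2) : ℝ) : ℂ), ?_, fun n => ?_⟩
    · rw [tendsto_nhdsWithin_iff]
      constructor
      · rw [← Complex.ofReal_zero, Filter.tendsto_ofReal_iff]
        exact tendsto_const_nhds.div_atTop
          (Filter.tendsto_atTop_add_const_right _ _ tendsto_natCast_atTop_atTop)
      · refine Filter.Eventually.of_forall fun n => ?_
        have : (ε / (n + 2) : ℝ) ≠ 0 := by positivity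
        simpa only [Set.mem_compl_iff, Set.mem_singleton_iff, Complex.ofReal_eq_zero] using this
    · rw [complexMGF_ofReal, complexMGF_ofReal]
      have h0 : 0 < ε / (n + 2) := by positivity
      refine congrArg _ (h _ ⟨by linarith, ?_⟩)
      rw [div_lt_iff₀ (by positivity)]
      nlinarith [(Nat.cast_nonneg n : (0 : ℝ) ≤ n)]
  have heq := (hsub hμ).eqOn_of_preconnected_of_frequently_eq (hsub hμ') hconv
    (z₀ := 0) (by simp [hε]) hfreq
  refine Measure.ext_of_charFun (funext fun t => ?_)
  rw [← complexMGF_id_mul_I, ← complexMGF_id_mul_I]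
  exact heq (by simp [hε])

namespace GenF

theorem total_pos {r : ℕ} (hr : 1 < r) {m : Fin r → ℝ} (hm : ∀ i, 0 < m i) : 0 < total m :=
  Finset.sum_pos (fun i _ => hm i) ⟨⟨0, by omega⟩, Finset.mem_univ _⟩

/-- The law of `∑ α_i X_i` as a mixture of gamma laws. -/
noncomputable def mixture {r : ℕ} (hr : 1 < r) (α m : Fin r → ℝ) : Measure ℝ :=
  Measure.sum fun j : ℕ => ENNReal.ofReal (c hr α m j) •
    gammaMeasure (total m / 2 + j) (1 / (2 * lastWeight hr α))

/-- With z = 1/(1 - 2 α_r t), one has 1 - u_i z = (α_r/α_i)(1 - 2 α_i t) z; the powers of z and of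
α_i/α_r then cancel. -/
theorem rpow_mul_genFun {r : ℕ} (hr : 1 < r) {α m : Fin r → ℝ}
    (hα_pos : ∀ i, 0 < α i) {t : ℝ} (ht : ∀ i, t * α i < 1 / 2) :
    (1 / (1 - 2 * lastWeight hr α * t)) ^ (total m / 2) *
        genFun hr α m (1 / (1 - 2 * lastWeight hr α * t)) =
      ∏ i, (1 / 2 / (1 / 2 - t * α i)) ^ (m i / 2) := by
  have hl := lastWeight_pos hr hα_pos
  have hlt : 0 < 1 - 2 * lastWeight hr α * t := by
    have : t * lastWeight hr α < 1 / 2 := ht _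
    linarith
  have htot : total m / 2 = ∑ i, m i / 2 := by rw [total, Finset.sum_div]
  rw [htot, Real.rpow_sum_of_pos (by positivity), genFun, A, ← Finset.prod_mul_distrib,
    ← Finset.prod_mul_distrib]
  refine Finset.prod_congr rfl fun i _ => ?_
  have hi := hα_pos i
  have hti : 0 < 1 - 2 * (t * α i) := by linarith [ht i]
  have e1 : 1 - u hr α i * (1 / (1 - 2 * lastWeight hr α * t)) =
      (lastWeight hr α / α i) * ((1 - 2 * (t * α i)) / (1 - 2 * lastWeight hr α * t)) := by
    have h1 : 1 - 2 * lastWeight hr α * t - u hr α i =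
        lastWeight hr α / α i * (1 - 2 * (t * α i)) := by
      rw [u]; field_simp; ring
    rw [← mul_div_assoc (lastWeight hr α / α i), ← h1, sub_div, div_self hlt.ne', mul_one_div]
  have e2 : 1 / 2 / (1 / 2 - t * α i) = (1 - 2 * (t * α i))⁻¹ := by
    have : 1 / 2 - t * α i = (1 - 2 * (t * α i)) / 2 := by ring
    rw [this]; field_simp
  rw [e1, e2, Real.rpow_neg (by positivity), Real.rpow_neg (by positivity),
    ← Real.inv_rpow (by positivity), ← Real.inv_rpow (by positivity),
    ← Real.mul_rpow (by positivity) (by positivity), ← Real.mul_rpow (by positivity) (by positivity)]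
  congr 1
  field_simp

theorem lintegral_exp_mul_mixture {r : ℕ} (hr : 1 < r) {α m : Fin r → ℝ} (hα_anti : Antitone α)
    (hα_pos : ∀ i, 0 < α i) (hm : ∀ i, 0 < m i) {t : ℝ} (ht : ∀ i, t * α i < 1 / 2)
    (htU : ∃ U, 0 ≤ U ∧ U < 1 ∧ (∀ i, u hr α i ≤ U) ∧ U < 1 - 2 * lastWeight hr α * t) :
    ∫⁻ x, ENNReal.ofReal (Real.exp (t * x)) ∂mixture hr α m =
      ENNReal.ofReal (∏ i, (1 / 2 / (1 / 2 - t * α i)) ^ (m i / 2)) := by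
  obtain ⟨U, hU0, hU1, hU, hUt⟩ := htU
  obtain ⟨hc, hs⟩ := c_nonneg_and_hasSum hr hα_anti hα_pos hm hU0 hU1 hU
  have hl := lastWeight_pos hr hα_pos
  have hp := total_pos hr hm
  have hlt : 0 < 1 - 2 * lastWeight hr α * t := by linarith
  set z := 1 / (1 - 2 * lastWeight hr α * t) with hz
  have hz0 : 0 < z := by positivity
  have hzU : |z| * U < 1 := by
    rw [abs_of_pos hz0, hz, one_div, inv_mul_lt_iff₀ hlt]; linarith
  have htl : t < 1 / (2 * lastWeight hr α) := by
    rw [lt_div_iff₀ (by positivity)]; linarith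
  have hsum := (hs z hzU).mul_left (z ^ (total m / 2))
  rw [hz, rpow_mul_genFun hr hα_pos ht, ← hz] at hsum
  rw [← hsum.tsum_eq, ENNReal.ofReal_tsum_of_nonneg
    (fun j => mul_nonneg (by positivity) (mul_nonneg (hc j) (by positivity))) hsum.summable,
    mixture, lintegral_sum_measure]
  refine tsum_congr fun j => ?_
  rw [lintegral_smul_measure, lintegral_exp_mul_gammaMeasure (by positivity) (by positivity) htl,
    smul_eq_mul, ← ENNReal.ofReal_mul (hc j)]
  have : 1 / (2 * lastWeight hr α) / (1 / (2 * lastWeight hr α) - t) = z := by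
    have : 1 / (2 * lastWeight hr α) - t =
      (1 - 2 * lastWeight hr α * t) / (2 * lastWeight hr α) := by field_simp
    rw [this, hz]; field_simp
  rw [this, Real.rpow_add hz0, Real.rpow_natCast]
  congr 1
  ring

theorem map_weighted_sum_eq_mixture {Ω : Type*} [MeasurableSpace Ω] (P : Measure Ω)
    [IsProbabilityMeasure P] {r : ℕ} (hr : 1 < r) {α m : Fin r → ℝ}
    (hα_anti : Antitone α) (hα_pos : ∀ i, 0 < α i) (hm : ∀ i, 0 < m i)
    {X : Fin r → Ω → ℝ} (hX : ∀ i, HasLaw (X i) (chiSquare (m i)) P) (hX_indep : iIndepFun X P) :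
    P.map (fun ω => ∑ i, α i * X i ω) = mixture hr α m := by
  obtain ⟨U, hU0, hU1, hU⟩ := exists_u_le hr hα_anti hα_pos
  have hl := lastWeight_pos hr hα_pos
  have hXm : ∀ i, AEMeasurable (X i) P := fun i => (hX i).aemeasurable
  set α₀ := α ⟨0, by omega⟩ with hα₀
  have hα₀_pos : 0 < α₀ := hα_pos _
  have hle : ∀ i, α i ≤ α₀ := fun i => hα_anti (Fin.le_def.2 (Nat.zero_le _))
  -- The first bound keeps every X_i factor finite, the second keeps z = 1/(1 - 2 α_r t) in the
  -- region |z| U < 1.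
  obtain ⟨ε, hε, hε1, hε2⟩ : ∃ ε > 0, ε * α₀ ≤ 1 / 2 ∧ 2 * lastWeight hr α * ε ≤ 1 - U := by
    refine ⟨min (1 / 2 / α₀) ((1 - U) / (2 * lastWeight hr α)),
      lt_min (by positivity) (div_pos (by linarith) (by positivity)), ?_, ?_⟩
    · rw [← le_div_iff₀ hα₀_pos]; exact min_le_left _ _
    · rw [mul_comm, ← le_div_iff₀ (by positivity)]; exact min_le_right _ _
  have ht : ∀ t ∈ Set.Ioo (-ε) ε, (∀ i, t * α i < 1 / 2) ∧ U < 1 - 2 * lastWeight hr α * t := by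
    intro t ht
    refine ⟨fun i => ?_, by nlinarith [ht.2]⟩
    have := hα_pos i
    have := hle i
    nlinarith [ht.2]
  have hmix := fun t ht' => lintegral_exp_mul_mixture hr hα_anti hα_pos hm (ht t ht').1
    ⟨U, hU0, hU1, hU, (ht t ht').2⟩
  have hYm : ∀ i, AEMeasurable (fun ω => α i * X i ω) P := fun i => (hXm i).const_mul _
  have hTm : AEMeasurable (fun ω => ∑ i, α i * X i ω) P := by fun_prop
  have hmgf : ∀ t ∈ Set.Ioo (-ε) ε, mgf id (P.map fun ω => ∑ i, α i * X i ω) t =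
      ∏ i, (1 / 2 / (1 / 2 - t * α i)) ^ (m i / 2) := by
    intro t ht'
    rw [mgf_id_map hTm]
    have hind : iIndepFun (fun i ω => α i * X i ω) P :=
      hX_indep.comp (fun i x => α i * x) (fun i => by fun_prop)
    have := hind.mgf_sum₀ (t := t) hYm Finset.univ
    rw [show (∑ i, fun ω => α i * X i ω) = fun ω => ∑ i, α i * X i ω from by
      ext ω; simp] at this
    rw [this]
    refine Finset.prod_congr rfl fun i _ => ?_
    rw [mgf_const_mul, ← mgf_id_map (hXm i), (hX i).map_eq, chiSquare,
      mgf_gammaMeasure (half_pos (hm i)) (by norm_num) (by linarith [(ht t ht').1 i]),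
      mul_comm (α i)]
  have hpos : ∀ t ∈ Set.Ioo (-ε) ε, 0 < ∏ i, (1 / 2 / (1 / 2 - t * α i)) ^ (m i / 2) := by
    intro t ht'
    refine Finset.prod_pos fun i _ => Real.rpow_pos_of_pos (div_pos (by norm_num) ?_) _
    linarith [(ht t ht').1 i]
  have : IsProbabilityMeasure (P.map fun ω => ∑ i, α i * X i ω) :=
    Measure.isProbabilityMeasure_map hTm
  -- The transform at t = 0 is the total mass.
  have hfin : IsFiniteMeasure (mixture hr α m) := by
    constructor
    have h0 := hmix 0 (by simp [hε])
    simp only [zero_mul, Real.exp_zero, ENNReal.ofReal_one, lintegral_one] at h0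
    rw [h0]; exact ENNReal.ofReal_lt_top
  refine ext_of_mgf_eqOn_Ioo hε (fun t ht' => ?_) (fun t ht' => ?_) (fun t ht' => ?_)
  · have := hpos t ht'
    rw [← hmgf t ht'] at this
    exact mgf_pos_iff.1 this
  · refine mem_integrableExpSet_of_lintegral_ne_top aemeasurable_id ?_
    simp only [id]
    rw [hmix t ht']; exact ENNReal.ofReal_ne_top
  · rw [hmgf t ht', mgf_eq_toReal_lintegral aemeasurable_id]
    simp only [id]
    rw [hmix t ht', ENNReal.toReal_ofReal (hpos t ht').le]

end GenF

/-! ### Series for the gamma distribution function -/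

theorem gammaMeasure_real_Iic {a r z : ℝ} (ha : 0 < a) (hr : 0 < r) (hz : 0 ≤ z) :
    (gammaMeasure a r).real (Set.Iic z) =
      ∫ x in (0 : ℝ)..z, r ^ a / Real.Gamma a * x ^ (a - 1) * Real.exp (-(r * x)) := by
  have := isProbabilityMeasure_gammaMeasure ha hr
  rw [← cdf_eq_real, cdf_gammaMeasure_eq_integral ha hr, intervalIntegral.integral_of_le hz,
    ← integral_Icc_eq_integral_Ioc]
  rw [setIntegral_eq_of_subset_of_forall_sdiff_eq_zero (s := Set.Icc 0 z) measurableSet_Iic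
    Set.Icc_subset_Iic_self]
  · refine setIntegral_congr_fun measurableSet_Icc fun x hx => ?_
    simp only [gammaPDFReal, if_pos hx.1]
  · intro x hx
    have : ¬ 0 ≤ x := fun h => hx.2 ⟨h, hx.1⟩
    simp only [gammaPDFReal, if_neg this]

theorem intervalIntegrable_gamma_density {a : ℝ} (ha : 0 < a) (r z : ℝ) :
    IntervalIntegrable (fun x => r ^ a / Real.Gamma a * x ^ (a - 1) * Real.exp (-(r * x)))
      volume 0 z :=
  ((intervalIntegral.intervalIntegrable_rpow' (by linarith)).const_mul _).mul_continuousOn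
    (by fun_prop)

/-- Up to a constant, x^a exp(-r x) is an antiderivative of the difference of the densities of
shapes a and a + 1. -/
theorem gammaMeasure_real_Iic_eq_add {a r z : ℝ} (ha : 0 < a) (hr : 0 < r) (hz : 0 ≤ z) :
    (gammaMeasure a r).real (Set.Iic z) = (gammaMeasure (a + 1) r).real (Set.Iic z) +
      (r * z) ^ a * Real.exp (-(r * z)) / Real.Gamma (a + 1) := by
  have hG := Real.Gamma_pos_of_pos ha
  have hint := (intervalIntegrable_gamma_density ha r z).sub
    (intervalIntegrable_gamma_density (a := a + 1) (by linarith) r z)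
  have h := intervalIntegral.integral_eq_sub_of_hasDerivAt_of_le hz
    (f := fun x => r ^ a / Real.Gamma (a + 1) * (x ^ a * Real.exp (-(r * x))))
    (f' := fun x => r ^ a / Real.Gamma a * x ^ (a - 1) * Real.exp (-(r * x)) -
      r ^ (a + 1) / Real.Gamma (a + 1) * x ^ (a + 1 - 1) * Real.exp (-(r * x)))
    (by
      refine ContinuousOn.mul (by fun_prop) (ContinuousOn.mul ?_ (by fun_prop))
      exact (Real.continuous_rpow_const ha.le).continuousOn)
    (fun x hx => by
      have h1 := Real.hasDerivAt_rpow_const (x := x) (p := a) (Or.inl hx.1.ne')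
      have h2 : HasDerivAt (fun x => Real.exp (-(r * x))) (Real.exp (-(r * x)) * -r) x := by
        simpa using (((hasDerivAt_id x).const_mul r).neg).exp
      convert! (h1.mul h2).const_mul (r ^ a / Real.Gamma (a + 1)) using 1
      rw [Real.rpow_add_one hr.ne', Real.Gamma_add_one ha.ne', add_sub_cancel_right]
      field_simp
      ring)
    hint
  rw [intervalIntegral.integral_sub (intervalIntegrable_gamma_density ha r z)
    (intervalIntegrable_gamma_density (a := a + 1) (by linarith) r z),
    ← gammaMeasure_real_Iic ha hr hz, ← gammaMeasure_real_Iic (by linarith) hr hz,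
    Real.zero_rpow ha.ne', zero_mul, mul_zero, sub_zero] at h
  rw [Real.mul_rpow hr.le hz]
  linear_combination h

/-- Chernoff bound at -r; the decay in the shape a kills the remainder of the telescoping sum in
`hasSum_gammaMeasure_real_Iic`. -/
theorem gammaMeasure_real_Iic_le {a r z : ℝ} (ha : 0 < a) (hr : 0 < r) :
    (gammaMeasure a r).real (Set.Iic z) ≤ Real.exp (r * z) * (1 / 2) ^ a := by
  have := isProbabilityMeasure_gammaMeasure ha hr
  have hm := mgf_gammaMeasure (t := -r) ha hr (by linarith)
  have hr2 : r / (r - -r) = 1 / 2 := by field_simp; ring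
  rw [hr2] at hm
  have hint : Integrable (fun x => Real.exp (-r * id x)) (gammaMeasure a r) := by
    refine mgf_pos_iff.1 ?_
    rw [hm]; positivity
  have h := measure_le_le_exp_mul_mgf (X := id) (μ := gammaMeasure a r) z (t := -r)
    (by linarith) hint
  rw [hm, neg_neg] at h
  exact h

/-- The Poisson-type series of the gamma distribution function. -/
theorem hasSum_gammaMeasure_real_Iic {a r z : ℝ} (ha : 0 < a) (hr : 0 < r) (hz : 0 ≤ z) :
    HasSum (fun k : ℕ => (r * z) ^ (a + k) * Real.exp (-(r * z)) / Real.Gamma (a + k + 1))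
      ((gammaMeasure a r).real (Set.Iic z)) := by
  have hpos : ∀ k : ℕ, 0 < a + k := fun k => by positivity
  rw [hasSum_iff_tendsto_nat_of_nonneg]
  · have hpart : ∀ n : ℕ, ∑ k ∈ Finset.range n,
        (r * z) ^ (a + k) * Real.exp (-(r * z)) / Real.Gamma (a + k + 1) =
        (gammaMeasure a r).real (Set.Iic z) - (gammaMeasure (a + n) r).real (Set.Iic z) := by
      intro n
      induction n with
      | zero => simp
      | succ n ih =>
        rw [Finset.sum_range_succ, ih, gammaMeasure_real_Iic_eq_add (hpos n) hr hz]
        push_cast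
        rw [add_assoc a]
        ring
    simp_rw [hpart]
    have hlim : Filter.Tendsto (fun n : ℕ => (gammaMeasure (a + n) r).real (Set.Iic z))
        Filter.atTop (nhds 0) := by
      have hg : Filter.Tendsto (fun n : ℕ => Real.exp (r * z) * ((1 / 2) ^ a * (1 / 2 : ℝ) ^ n))
          Filter.atTop (nhds 0) := by
        have := ((tendsto_pow_atTop_nhds_zero_of_lt_one (r := (1 / 2 : ℝ)) (by norm_num)
          (by norm_num)).const_mul ((1 / 2 : ℝ) ^ a)).const_mul (Real.exp (r * z))
        simpa using this
      refine squeeze_zero (fun n => measureReal_nonneg) (fun n => ?_) hg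
      have := gammaMeasure_real_Iic_le (z := z) (hpos n) hr
      rwa [Real.rpow_add (by norm_num), Real.rpow_natCast] at this
    simpa using hlim.const_sub ((gammaMeasure a r).real (Set.Iic z))
  · intro k
    have := Real.Gamma_pos_of_pos (show 0 < a + k + 1 by positivity)
    positivity

theorem gammaMeasure_Iic_eq_tsum {a r z : ℝ} (ha : 0 < a) (hr : 0 < r) (hz : 0 ≤ z) :
    gammaMeasure a r (Set.Iic z) = ∑' k : ℕ, ENNReal.ofReal
      ((r * z) ^ (a + k) * Real.exp (-(r * z)) / Real.Gamma (a + k + 1)) := by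
  have := isProbabilityMeasure_gammaMeasure ha hr
  have h := hasSum_gammaMeasure_real_Iic ha hr hz
  rw [← ENNReal.ofReal_tsum_of_nonneg _ h.summable, h.tsum_eq, measureReal_def,
    ENNReal.ofReal_toReal (measure_ne_top _ _)]
  intro k
  have := Real.Gamma_pos_of_pos (show 0 < a + k + 1 by positivity)
  positivity

/-! ### Averaging over the denominator -/

theorem ae_pos_gammaMeasure (a r : ℝ) : ∀ᵐ x ∂gammaMeasure a r, 0 < x := by
  have hm : Measurable (gammaPDF a r) := (measurable_gammaPDFReal a r).ennreal_ofReal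
  rw [gammaMeasure, ae_withDensity_iff hm]
  have h0 : ∀ᵐ x : ℝ, x ≠ 0 := by simp [ae_iff]
  filter_upwards [h0] with x hx h
  rcases lt_or_gt_of_ne hx with h' | h'
  · exact absurd (gammaPDF_of_neg h') h
  · exact h'

/-- The integrand times the density of V is a multiple of the gamma density of shape q + s and rate
b + κ. -/
theorem lintegral_rpow_mul_exp_gammaMeasure {q κ s b : ℝ} (hq : 0 < q) (hκ : 0 < κ) (hs : 0 < s)
    (hb : 0 ≤ b) :
    ∫⁻ v, ENNReal.ofReal ((b * v) ^ s * Real.exp (-(b * v)) / Real.Gamma (s + 1))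
      ∂gammaMeasure q κ =
      ENNReal.ofReal (b ^ s * κ ^ q * Real.Gamma (q + s) /
        (Real.Gamma q * Real.Gamma (s + 1) * (b + κ) ^ (q + s))) := by
  have hm : Measurable (gammaPDF q κ) := (measurable_gammaPDFReal q κ).ennreal_ofReal
  have hbκ : 0 < b + κ := by linarith
  have hG1 := Real.Gamma_pos_of_pos hq
  have hG2 := Real.Gamma_pos_of_pos (show 0 < s + 1 by linarith)
  have hG3 := Real.Gamma_pos_of_pos (show 0 < q + s by linarith)
  rw [gammaMeasure, lintegral_withDensity_eq_lintegral_mul _ hm (by fun_prop)]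
  have h : ∀ᵐ v : ℝ, (gammaPDF q κ * fun v => ENNReal.ofReal
      ((b * v) ^ s * Real.exp (-(b * v)) / Real.Gamma (s + 1))) v =
      ENNReal.ofReal (b ^ s * κ ^ q * Real.Gamma (q + s) /
        (Real.Gamma q * Real.Gamma (s + 1) * (b + κ) ^ (q + s))) *
        gammaPDF (q + s) (b + κ) v := by
    -- Splitting v^(q - 1 + s) into a product of powers requires v ≠ 0.
    have h0 : ∀ᵐ x : ℝ, x ≠ 0 := by simp [ae_iff]
    filter_upwards [h0] with v hv
    rw [Pi.mul_apply, gammaPDF, gammaPDF, ← ENNReal.ofReal_mul (gammaPDFReal_nonneg hq hκ v),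
      ← ENNReal.ofReal_mul (by positivity)]
    congr 1
    unfold gammaPDFReal
    split_ifs with h
    · have hv' : 0 < v := lt_of_le_of_ne h hv.symm
      rw [Real.mul_rpow hb h, show -((b + κ) * v) = -(κ * v) + -(b * v) by ring, Real.exp_add,
        show q + s - 1 = (q - 1) + s by ring, Real.rpow_add hv' (q - 1) s]
      have := (Real.rpow_pos_of_pos hbκ (q + s)).ne'
      field_simp
    · simp
  rw [lintegral_congr_ae h, lintegral_const_mul' _ _ ENNReal.ofReal_ne_top,
    lintegral_gammaPDF_eq_one (by linarith) hbκ, mul_one]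

/-- The `s`-th term in the series for `P(G ≤ (b / r) V)`, where `G` and `V` are gamma variables of
rates `r` and `κ`, and `V` has shape `q`. -/
noncomputable def betaTerm (b κ q s : ℝ) : ℝ :=
  b ^ s * κ ^ q * Real.Gamma (q + s) /
    (Real.Gamma q * Real.Gamma (s + 1) * (b + κ) ^ (q + s))

/-- The terms depend on s and k only through s + k, which lets the series for different shapes share
their terms. -/
theorem lintegral_gammaMeasure_Iic_mul {s r q κ x : ℝ} (hs : 0 < s) (hr : 0 < r) (hq : 0 < q)
    (hκ : 0 < κ) (hx : 0 ≤ x) :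
    ∫⁻ v, gammaMeasure s r (Set.Iic (x * v)) ∂gammaMeasure q κ =
      ∑' k : ℕ, ENNReal.ofReal (betaTerm (r * x) κ q (s + k)) := by
  have h : ∀ᵐ v ∂gammaMeasure q κ, gammaMeasure s r (Set.Iic (x * v)) = ∑' k : ℕ, ENNReal.ofReal
      ((r * x * v) ^ (s + k) * Real.exp (-(r * x * v)) / Real.Gamma (s + k + 1)) := by
    filter_upwards [ae_pos_gammaMeasure q κ] with v hv
    rw [gammaMeasure_Iic_eq_tsum hs hr (by positivity), mul_assoc]
  rw [lintegral_congr_ae h, lintegral_tsum (fun k => by fun_prop)]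
  refine tsum_congr fun k => ?_
  rw [lintegral_rpow_mul_exp_gammaMeasure hq hκ (by positivity) (by positivity), betaTerm]

/-! ### Rearranging and truncating the double series -/

theorem ENNReal.tsum_mul_tsum_add (e d : ℕ → ENNReal) :
    ∑' j, e j * ∑' k, d (j + k) = ∑' n, d n * ∑ j ∈ Finset.range (n + 1), e j := by
  simp_rw [← ENNReal.tsum_mul_left]
  rw [← ENNReal.tsum_prod (f := fun j k => e j * d (j + k)),
    ← Finset.HasAntidiagonal.sigmaAntidiagonalEquivProd.tsum_eq, ENNReal.tsum_sigma']
  refine tsum_congr fun n => ?_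
  rw [tsum_fintype, Finset.mul_sum]
  rw [← Finset.Nat.sum_antidiagonal_eq_sum_range_succ (fun i _ => d n * e i) n,
    ← Finset.sum_coe_sort (Finset.HasAntidiagonal.antidiagonal n)]
  refine Finset.sum_congr rfl fun jk _ => ?_
  have := Finset.HasAntidiagonal.mem_antidiagonal.1 jk.2
  simp only [Finset.HasAntidiagonal.sigmaAntidiagonalEquivProd_apply]
  rw [this, mul_comm]

/-- Replacing the tail of `∑ d_k S_k` by that of `∑ d_k` for a monotone `S ≤ 1`. -/
theorem abs_tsum_mul_sub_le {d S : ℕ → ℝ} (hd : ∀ k, 0 ≤ d k) (hd_sum : Summable d)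
    (hS0 : ∀ k, 0 ≤ S k) (hS1 : ∀ k, S k ≤ 1) (hS : Monotone S) (N : ℕ) :
    |∑' k, d k * S k - (∑ k ∈ Finset.range N, d k * S k + ∑' k, d (k + N))| ≤
      (1 - S N) * ∑' k, d (k + N) := by
  have hdS : Summable fun k => d k * S k :=
    hd_sum.of_nonneg_of_le (fun k => mul_nonneg (hd k) (hS0 k))
      fun k => mul_le_of_le_one_right (hd k) (hS1 k)
  have hdN := (summable_nat_add_iff N).2 hd_sum
  have hdSN := (summable_nat_add_iff N).2 hdS
  have hle : ∑' k, d (k + N) * S (k + N) ≤ ∑' k, d (k + N) :=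
    hdSN.tsum_le_tsum (fun k => mul_le_of_le_one_right (hd _) (hS1 _)) hdN
  have hge : S N * ∑' k, d (k + N) ≤ ∑' k, d (k + N) * S (k + N) := by
    rw [← tsum_mul_left]
    refine (hdN.mul_left _).tsum_le_tsum (fun k => ?_) hdSN
    rw [mul_comm]
    exact mul_le_mul_of_nonneg_left (hS (Nat.le_add_left _ _)) (hd _)
  -- The first N terms cancel; the remaining difference lies between -(1 - S_N) times the tail and
  -- 0.
  rw [← hdS.sum_add_tsum_nat_add N, abs_le]
  constructor <;> linarith

theorem Real.Gamma_add_natCast_eq_ascPochhammer {x : ℝ} (hx : 0 < x) (n : ℕ) :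
    Real.Gamma (x + n) = (ascPochhammer ℝ n).eval x * Real.Gamma x := by
  induction n with
  | zero => simp
  | succ n ih =>
    rw [ascPochhammer_succ_eval, Nat.cast_succ, ← add_assoc, Real.Gamma_add_one (by positivity), ih]
    ring

/-! ### The series of the distribution function of W -/

namespace GenF

theorem poch_pos {x : ℝ} (hx : 0 < x) (n : ℕ) : 0 < poch x n := ascPochhammer_pos n x hx

theorem poch_add {x : ℝ} (k n : ℕ) : poch x (k + n) = poch x k * poch (x + k) n := by
  simp [poch, ← ascPochhammer_mul]

theorem a_pos {r : ℕ} (hr : 1 < r) {α m : Fin r → ℝ} {ν : ℝ} (hα_pos : ∀ i, 0 < α i)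
    (hm : ∀ i, 0 < m i) (hν : 0 < ν) : 0 < a hr α m ν :=
  div_pos (mul_pos hν (lastWeight_pos hr hα_pos)) (total_pos hr hm)

/-- The `k`-th term, without the factor `∑ c_i`, of the series of the distribution function. -/
noncomputable def seriesTerm {r : ℕ} (hr : 1 < r) (α m : Fin r → ℝ) (ν y : ℝ) (k : ℕ) : ℝ :=
  B₀ hr α m ν * B₁ hr α m ν y * (y / (total m / 2)) *
    (poch ((ν + total m) / 2) k / poch (total m / 2 + 1) k * t hr α m ν y ^ k)

/-- Here b = y/(2a) and κ = 1/2, so b/(b + κ) = t(y), and the Gamma quotients become rising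
factorials. -/
theorem betaTerm_eq_seriesTerm {r : ℕ} (hr : 1 < r) {α m : Fin r → ℝ} {ν y : ℝ}
    (hα_pos : ∀ i, 0 < α i) (hm : ∀ i, 0 < m i) (hν : 0 < ν) (hy : 0 ≤ y) (k : ℕ) :
    betaTerm (1 / (2 * lastWeight hr α) * (total m * y / ν)) (1 / 2) (ν / 2) (total m / 2 + k) =
      seriesTerm hr α m ν y k := by
  have ha := a_pos hr hα_pos hm hν
  have hp := total_pos hr hm
  have hl := lastWeight_pos hr hα_pos
  have hb : 1 / (2 * lastWeight hr α) * (total m * y / ν) = y / (2 * a hr α m ν) := by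
    rw [a]; field_simp
  rw [hb, betaTerm, seriesTerm]
  rcases hy.eq_or_lt with rfl | hy'
  -- At y = 0 the left side vanishes because its exponent is positive, the right side because of its
  -- factor y.
  · rw [zero_div, Real.zero_rpow (by positivity)]
    simp
  unfold B₀ B₁ t poch
  generalize a hr α m ν = a' at ha
  have hG0 := Real.Gamma_add_natCast_eq_ascPochhammer (x := (ν + total m) / 2) (by positivity) k
  have hG1 := Real.Gamma_add_natCast_eq_ascPochhammer (x := total m / 2 + 1) (by positivity) k
  have e1 : ν / 2 + (total m / 2 + k) = (ν + total m) / 2 + k := by ring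
  have e2 : total m / 2 + k + 1 = total m / 2 + 1 + k := by ring
  have e3 : y / (2 * a') + 1 / 2 = (a' + y) / (2 * a') := by field_simp; ring
  rw [e1, e2, e3, hG0, hG1, Real.Gamma_add_one (by positivity)]
  have hGp := Real.Gamma_pos_of_pos (show 0 < total m / 2 by positivity)
  have hGq := Real.Gamma_pos_of_pos (show 0 < ν / 2 by positivity)
  have hP := ascPochhammer_pos k (total m / 2 + 1) (by positivity)
  have hay : 0 < a' + y := by positivity
  have hy2 : y ^ ((total m - 2) / 2) = y ^ (total m / 2) / y := by
    rw [sub_div, div_self two_ne_zero, Real.rpow_sub_one hy'.ne']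
  have h2a : (2 * a') ^ ((ν + total m) / 2) = 2 ^ (ν / 2) * a' ^ (ν / 2) * (2 * a') ^ (total m / 2) := by
    rw [add_div, Real.rpow_add (by positivity), Real.mul_rpow zero_le_two ha.le]
  rw [Real.div_rpow hy'.le (by positivity), Real.div_rpow hay.le (by positivity),
    Real.div_rpow zero_le_one zero_le_two, Real.one_rpow, Real.rpow_add hy', Real.rpow_add hay,
    Real.rpow_add (x := 2 * a') (by positivity) (total m / 2),
    Real.rpow_add (x := 2 * a') (by positivity) ((ν + total m) / 2), h2a, hy2]
  simp only [Real.rpow_natCast]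
  have i1 := Real.rpow_pos_of_pos (show 0 < 2 * a' by positivity) (total m / 2)
  have i2 := Real.rpow_pos_of_pos ha (ν / 2)
  have i3 := Real.rpow_pos_of_pos (zero_lt_two (α := ℝ)) (ν / 2)
  have i4 := Real.rpow_pos_of_pos hay ((ν + total m) / 2)
  have i5 : 0 < (2 * a') ^ k := by positivity
  generalize (2 * a') ^ (total m / 2) = z1 at *
  generalize (2 * a') ^ k = z2 at *
  generalize a' ^ (ν / 2) = z3 at *
  generalize (2 : ℝ) ^ (ν / 2) = z4 at *
  generalize (a' + y) ^ ((ν + total m) / 2) = z5 at *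
  generalize y ^ (total m / 2) = z6 at *
  rw [div_pow]
  field_simp

/-- Since (1)_k = k!, the numerator parameter 1 cancels the factorial of `₂F₁`, leaving the shifted
series term by term. -/
theorem correction_eq_tsum {r : ℕ} (hr : 1 < r) {α m : Fin r → ℝ} (ν y : ℝ) (τ : ℕ) :
    correction hr α m ν τ y = ∑' k, seriesTerm hr α m ν y (k + (τ + 1)) := by
  have hF := congrFun (ordinaryHypergeometric_eq_tsum (𝔸 := ℝ) ((ν + total m) / 2 + τ + 1) (1 : ℝ)
    (total m / 2 + τ + 2)) (t hr α m ν y)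
  rw [correction, hF, ← tsum_mul_left]
  refine tsum_congr fun k => ?_
  rw [seriesTerm, add_comm k, poch_add (τ + 1) k, poch_add (τ + 1) k, ascPochhammer_eval_one,
    pow_add (t hr α m ν y) (τ + 1) k,
    show (ν + total m) / 2 + ((τ + 1 : ℕ) : ℝ) = (ν + total m) / 2 + τ + 1 by push_cast; ring,
    show total m / 2 + 1 + ((τ + 1 : ℕ) : ℝ) = total m / 2 + τ + 2 by push_cast; ring]
  have hk : ((k.factorial : ℕ) : ℝ) ≠ 0 := by positivity
  simp only [poch, smul_eq_mul]
  field_simp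

theorem measure_W_le_eq_tsum {Ω : Type*} [MeasurableSpace Ω] (P : Measure Ω)
    [IsProbabilityMeasure P] {r : ℕ} (hr : 1 < r) {α m : Fin r → ℝ} {ν : ℝ}
    (hα_anti : Antitone α) (hα_pos : ∀ i, 0 < α i) (hm : ∀ i, 0 < m i) (hν : 0 < ν)
    {X : Fin r → Ω → ℝ} {V : Ω → ℝ} (hX : ∀ i, HasLaw (X i) (chiSquare (m i)) P)
    (hX_indep : iIndepFun X P) (hV : HasLaw V (chiSquare ν) P)
    (hXV : IndepFun (fun ω i => X i ω) V P) {y : ℝ} (hy : 0 ≤ y) :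
    P {ω | W α m ν X V ω ≤ y} = ∑' k, ENNReal.ofReal (seriesTerm hr α m ν y k) *
      ∑ i ∈ Finset.range (k + 1), ENNReal.ofReal (c hr α m i) := by
  have hp := total_pos hr hm
  have hl := lastWeight_pos hr hα_pos
  -- As V > 0 almost surely, W ≤ y amounts to T ≤ x V.
  set x := total m * y / ν with hx
  have hx0 : 0 ≤ x := by positivity
  have hXm : ∀ i, AEMeasurable (X i) P := fun i => (hX i).aemeasurable
  have hTm : AEMeasurable (fun ω => ∑ i, α i * X i ω) P := by fun_prop
  have hind : IndepFun (fun ω => ∑ i, α i * X i ω) V P :=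
    hXV.comp (φ := fun f : Fin r → ℝ => ∑ i, α i * f i) (ψ := id) (by fun_prop) measurable_id
  have hVpos : ∀ᵐ ω ∂P, 0 < V ω := by
    refine ae_of_ae_map (p := fun v => 0 < v) hV.aemeasurable ?_
    rw [hV.map_eq]
    exact ae_pos_gammaMeasure _ _
  have hset : {ω | W α m ν X V ω ≤ y} =ᵐ[P]
      (fun ω => (∑ i, α i * X i ω, V ω)) ⁻¹' {q : ℝ × ℝ | q.1 ≤ x * q.2} := by
    rw [Filter.eventuallyEq_set]
    filter_upwards [hVpos] with ω hω
    simp only [Set.mem_ofPred_eq, Set.mem_preimage, W]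
    rw [div_le_iff₀ (by positivity), div_le_iff₀ hp, hx]
    rw [show y * (V ω / ν) * total m = total m * y / ν * V ω by ring]
  have hmS : MeasurableSet {q : ℝ × ℝ | q.1 ≤ x * q.2} :=
    measurableSet_le measurable_fst (by fun_prop)
  have : IsProbabilityMeasure (chiSquare ν) :=
    isProbabilityMeasure_gammaMeasure (half_pos hν) (by norm_num)
  have hmix : IsProbabilityMeasure (mixture hr α m) := by
    rw [← map_weighted_sum_eq_mixture P hr hα_anti hα_pos hm hX hX_indep]
    exact Measure.isProbabilityMeasure_map hTm
  rw [measure_congr hset, ← Measure.map_apply_of_aemeasurable (hTm.prodMk hV.aemeasurable) hmS,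
    hind.map_prod_eq_prod_map_map hTm hV.aemeasurable, hV.map_eq,
    map_weighted_sum_eq_mixture P hr hα_anti hα_pos hm hX hX_indep,
    Measure.prod_apply_symm hmS]
  have hslice : ∀ v : ℝ, mixture hr α m ((fun s => (s, v)) ⁻¹' {q : ℝ × ℝ | q.1 ≤ x * q.2}) =
      ∑' j : ℕ, ENNReal.ofReal (c hr α m j) *
        gammaMeasure (total m / 2 + j) (1 / (2 * lastWeight hr α)) (Set.Iic (x * v)) := by
    intro v
    rw [mixture, Measure.sum_apply _ (measurable_prodMk_right hmS)]
    rfl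
  simp_rw [hslice]
  -- Measurability in v comes from monotonicity, as x ≥ 0.
  have hmeas : ∀ j : ℕ, Measurable fun v => gammaMeasure (total m / 2 + j)
      (1 / (2 * lastWeight hr α)) (Set.Iic (x * v)) := fun j =>
    Monotone.measurable fun v w hvw =>
      measure_mono (Set.Iic_subset_Iic.2 (mul_le_mul_of_nonneg_left hvw hx0))
  rw [lintegral_tsum fun j => ((hmeas j).const_mul _).aemeasurable]
  rw [← ENNReal.tsum_mul_tsum_add]
  refine tsum_congr fun j => ?_
  rw [lintegral_const_mul' _ _ ENNReal.ofReal_ne_top, chiSquare,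
    lintegral_gammaMeasure_Iic_mul (by positivity) (by positivity) (by positivity) (by norm_num) hx0]
  congr 1
  refine tsum_congr fun k => ?_
  rw [add_assoc, ← Nat.cast_add, betaTerm_eq_seriesTerm hr hα_pos hm hν hy]

theorem seriesTerm_nonneg {r : ℕ} (hr : 1 < r) {α m : Fin r → ℝ} {ν y : ℝ}
    (hα_pos : ∀ i, 0 < α i) (hm : ∀ i, 0 < m i) (hν : 0 < ν) (hy : 0 ≤ y) (k : ℕ) :
    0 ≤ seriesTerm hr α m ν y k := by
  have ha := a_pos hr hα_pos hm hν
  have hp := total_pos hr hm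
  have h1 := poch_pos (show 0 < (ν + total m) / 2 by positivity) k
  have h2 := poch_pos (show 0 < total m / 2 + 1 by positivity) k
  have h3 := Real.Gamma_pos_of_pos (show 0 < (ν + total m) / 2 by positivity)
  have h4 := Real.Gamma_pos_of_pos (show 0 < total m / 2 by positivity)
  have h5 := Real.Gamma_pos_of_pos (show 0 < ν / 2 by positivity)
  unfold seriesTerm B₀ B₁ t
  positivity

/-- The sum is itself a probability, that of G ≤ x V for a gamma variable G of shape |m|/2, hence
finite. -/
theorem summable_seriesTerm {r : ℕ} (hr : 1 < r) {α m : Fin r → ℝ} {ν y : ℝ}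
    (hα_pos : ∀ i, 0 < α i) (hm : ∀ i, 0 < m i) (hν : 0 < ν) (hy : 0 ≤ y) :
    Summable (seriesTerm hr α m ν y) := by
  have hp := total_pos hr hm
  have hl := lastWeight_pos hr hα_pos
  have h := lintegral_gammaMeasure_Iic_mul (s := total m / 2) (r := 1 / (2 * lastWeight hr α))
    (q := ν / 2) (κ := 1 / 2) (x := total m * y / ν) (by positivity) (by positivity)
    (by positivity) (by norm_num) (by positivity)
  simp_rw [betaTerm_eq_seriesTerm hr hα_pos hm hν hy] at h
  have := isProbabilityMeasure_gammaMeasure (a := total m / 2) (r := 1 / (2 * lastWeight hr α))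
    (by positivity) (by positivity)
  have := isProbabilityMeasure_gammaMeasure (a := ν / 2) (r := 1 / 2)
    (by positivity) (by norm_num)
  have hne : ∑' k, ENNReal.ofReal (seriesTerm hr α m ν y k) ≠ ⊤ := by
    rw [← h]
    refine ne_top_of_le_ne_top ENNReal.one_ne_top ((lintegral_mono fun v => prob_le_one).trans ?_)
    rw [lintegral_one]
    exact prob_le_one
  refine (ENNReal.summable_toReal hne).congr fun k => ?_
  rw [ENNReal.toReal_ofReal (seriesTerm_nonneg hr hα_pos hm hν hy k)]

end GenF

/-! ### The error bound -/

theorem theorem4 {Ω : Type*} [MeasurableSpace Ω] (P : Measure Ω) [IsProbabilityMeasure P]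
    (r : ℕ) (hr : 1 < r) (α m : Fin r → ℝ) (ν : ℝ)
    (hα_anti : Antitone α) (hα_pos : ∀ i, 0 < α i) (hm : ∀ i, 0 < m i) (hν : 0 < ν)
    (X : Fin r → Ω → ℝ) (V : Ω → ℝ)
    (hX : ∀ i, HasLaw (X i) (GenF.chiSquare (m i)) P)
    (hX_indep : iIndepFun X P)
    (hV : HasLaw V (GenF.chiSquare ν) P)
    (hXV : IndepFun (fun ω i => X i ω) V P)
    (τ : ℕ) (y : ℝ) (hy : 0 ≤ y) :
    |P.real {ω | GenF.W α m ν X V ω ≤ y} -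
        (GenF.HHat hr α m ν τ y + GenF.correction hr α m ν τ y)| ≤
      GenF.errorBound hr α m ν τ y := by
  obtain ⟨U, hU0, hU1, hU⟩ := GenF.exists_u_le hr hα_anti hα_pos
  obtain ⟨hc, hs⟩ := GenF.c_nonneg_and_hasSum hr hα_anti hα_pos hm hU0 hU1 hU
  have hc1 := hs 1 (by simpa using hU1)
  simp only [one_pow, mul_one, GenF.genFun_one hr m hα_pos] at hc1
  set S : ℕ → ℝ := fun k => ∑ i ∈ Finset.range (k + 1), GenF.c hr α m i with hS
  have hS0 : ∀ k, 0 ≤ S k := fun k => Finset.sum_nonneg fun i _ => hc i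
  have hS1 : ∀ k, S k ≤ 1 := fun k => sum_le_hasSum _ (fun i _ => hc i) hc1
  have hSm : Monotone S := fun j k hjk => Finset.sum_le_sum_of_subset_of_nonneg
    (Finset.range_mono (by omega)) fun i _ _ => hc i
  have hd := GenF.seriesTerm_nonneg hr hα_pos hm hν hy
  have hP : P.real {ω | GenF.W α m ν X V ω ≤ y} = ∑' k, GenF.seriesTerm hr α m ν y k * S k := by
    rw [measureReal_def, GenF.measure_W_le_eq_tsum P hr hα_anti hα_pos hm hν hX hX_indep hV hXV hy]
    simp_rw [← ENNReal.ofReal_sum_of_nonneg fun i _ => hc i, ← ENNReal.ofReal_mul (hd _)]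
    rw [ENNReal.tsum_toReal_eq fun k => ENNReal.ofReal_ne_top]
    exact tsum_congr fun k => ENNReal.toReal_ofReal (mul_nonneg (hd k) (hS0 k))
  have hH : GenF.HHat hr α m ν τ y =
      ∑ k ∈ Finset.range (τ + 1), GenF.seriesTerm hr α m ν y k * S k := by
    rw [GenF.HHat, Finset.mul_sum]
    exact Finset.sum_congr rfl fun k _ => (mul_assoc _ _ _).symm
  rw [hP, hH, GenF.errorBound, GenF.correction_eq_tsum]
  -- With N = τ + 1, S N sums c_0, …, c_(τ+1), the range used in `errorBound`.
  exact abs_tsum_mul_sub_le hd (GenF.summable_seriesTerm hr hα_pos hm hν hy) hS0 hS1 hSm (τ + 1)
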